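/- Let $(G,I,O)$ be an open graph, i.e. a finite simple undirected graph $G$ on a vertex set $V$ together with sets $I,O\subseteq V$ of input and output vertices. Write $X^C=V\setminus X$, let $N(v)$ be the neighbourhood of $v$, and for $K\subseteq V$ let $Odd(K)=\{k\in V : |N(k)\cap K| \text{ is odd}\}$. A *flow* $(f,\prec_f)$ is a map $f:O^C\to I^C$ with a strict partial order $\prec_f$ on $V$ such that for all $i\in O^C$: $i\prec_f f(i)$; if $j\in N(f(i))$ then $j=i$ or $i\prec_f j$; and $i\in N(f(i))$. A *gflow* $(g,\prec_g)$ is a map $g$ from $O^C$ to the subsets of $I^C$ with a strict partial order $\prec_g$ on $V$ such that for all $i\in O^C$: if $j\in g(i)$ then $i\prec_g j$; if $j\in Odd(g(i))$ then $j=i$ or $i\prec_g j$; and $i\in Odd(g(i))$. The layers of a strict order $\prec$ on $V$ are defined by letting $V_k^{\prec}$ be the set of $\prec$-maximal elements of $V\setminus\bigcup_{i<k}V_i^{\prec}$, for $k\ge 0$. A gflow $(g,\prec_g)$ is *more delayed* than a gflow $(g',\prec_{g'})$ if $|\bigcup_{i\le k}V_i^{\prec_g}|\ge|\bigcup_{i\le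 k}V_i^{\prec_{g'}}|$ for all $k$, with strict inequality for some $k$; a gflow is *optimal* (maximally delayed) if no gflow of the same open graph is more delayed. Given a flow $(f,\prec_f)$, let $G_Z$ be the directed graph on $V$ with an edge from $i$ to $j$ iff $i\in O^C$ and $j\in N(f(i))\setminus\{i\}$; it is acyclic. Let $\zeta_i(j)$ be the number of directed paths from $i$ to $j$ in $G_Z$, with $\zeta_i(i)=1$. The *signal shifted flow* $(s,\prec_s)$ of $(f,\prec_f)$ is given, for $i\in O^C$, by $j\in s(i)$ iff $j=f(k)$ for some $k\in O^C$ with $\zeta_i(k)$ odd ($k$ is unique, since $f$ is injective), and by $i\prec_s j \Leftrightarrow L_s(i)>L_s(j)$, where $L_s(i)=0$ for $i\in O$ and $L_s(i)=\max_{j\in s(i)}(L_s(j)+1)$ for $i\notin O$ (this recursion is well founded). **Theorem.** Let $(G,I,O)$ be an open graph with flow $(f,\prec_f)$ such that $|I|=|O|$, and let $(s,\prec_s)$ be the signal shifted flow obtained from $(f,\prec_f)$. Then $(s,\prec_s)$ is an optimal gflow of $(G,I,O)$, and its layering is that of every optimal gflow: $V_k^{\prec_s}=V_k^{\prec_g}$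 for every optimal gflow $(g,\prec_g)$ of $(G,I,O)$ and every $k\ge 0$. -/

import Mathlib

/-- An open graph `(G, I, O)`: an undirected graph on the vertex set `V` with a set `I` of input
vertices and a set `O` of output vertices. -/
structure OpenGraph (V : Type*) where
  /-- the underlying undirected graph -/
  G : SimpleGraph V
  /-- the input vertices -/
  I : Finset V
  /-- the output vertices -/
  O : Finset V

namespace OpenGraph

variable {V : Type*}

/-- A flow `(f, ≺)` on an open graph: a map `f : Oᶜ → Iᶜ` and a strict partial order `≺` on all
vertices with properties (F1), (F2), (F3). -/
structure Flow (Γ : OpenGraph V) where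
  /-- the flow function -/
  f : {v : V // v ∉ Γ.O} → {v : V // v ∉ Γ.I}
  /-- the strict partial order of the flow; `lt i j` is `i ≺ j` -/
  lt : V → V → Prop
  strictOrder : IsStrictOrder V lt
  F1 : ∀ i : {v : V // v ∉ Γ.O}, lt i (f i)
  F2 : ∀ i : {v : V // v ∉ Γ.O}, ∀ j ∈ Γ.G.neighborSet (f i), j = i ∨ lt i j
  F3 : ∀ i : {v : V // v ∉ Γ.O}, (i : V) ∈ Γ.G.neighborSet (f i)

/-- `Odd(K)`: the vertices with an odd number of neighbours in `K`. -/
def oddNeighborhood (Γ : OpenGraph V) (K : Set V) : Set V :=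
  {k | Odd (Γ.G.neighborSet k ∩ K).ncard}

/-- `(g, ≺)` is a generalised flow (gflow) of the open graph: `≺` is a strict partial order on all
vertices and `g` maps non-output vertices to sets of non-input vertices such that (G1), (G2), (G3)
hold. -/
structure IsGFlow (Γ : OpenGraph V) (g : {v : V // v ∉ Γ.O} → Set V) (lt : V → V → Prop) :
    Prop where
  strictOrder : IsStrictOrder V lt
  nonInput : ∀ i : {v : V // v ∉ Γ.O}, ∀ j ∈ g i, j ∉ Γ.I
  G1 : ∀ i : {v : V // v ∉ Γ.O}, ∀ j ∈ g i, lt i j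
  G2 : ∀ i : {v : V // v ∉ Γ.O}, ∀ j ∈ Γ.oddNeighborhood (g i), j = i ∨ lt i j
  G3 : ∀ i : {v : V // v ∉ Γ.O}, (i : V) ∈ Γ.oddNeighborhood (g i)

/-- The elements of `X` that are maximal with respect to `lt`. -/
def maxElements (lt : V → V → Prop) (X : Set V) : Set V :=
  {u | u ∈ X ∧ ∀ v ∈ X, ¬ lt u v}

/-- The `k`-th layer of a strict order: the maximal elements of what remains of the vertex set
after all layers with smaller index have been removed. -/
def layer (lt : V → V → Prop) (k : ℕ) : Set V :=
  maxElements lt (Set.univ \ ⋃ i : Fin k, layer lt i)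
termination_by k
decreasing_by exact i.isLt

/-- The union of the layers `0, …, k`. -/
def layersUpTo (lt : V → V → Prop) (k : ℕ) : Set V :=
  ⋃ i ∈ Finset.range (k + 1), layer lt i

/-- A gflow with order `lt` is more delayed than a gflow with order `lt'`. -/
def MoreDelayed (lt lt' : V → V → Prop) : Prop :=
  (∀ k, (layersUpTo lt' k).ncard ≤ (layersUpTo lt k).ncard) ∧
    ∃ k, (layersUpTo lt' k).ncard < (layersUpTo lt k).ncard

/-- `(g, ≺)` is a maximally delayed (optimal) gflow: it is a gflow, and no gflow of the same open
graph is more delayed. -/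
def IsMaximallyDelayedGFlow (Γ : OpenGraph V) (g : {v : V // v ∉ Γ.O} → Set V)
    (lt : V → V → Prop) : Prop :=
  Γ.IsGFlow g lt ∧
    ¬ ∃ (g' : {v : V // v ∉ Γ.O} → Set V) (lt' : V → V → Prop),
      Γ.IsGFlow g' lt' ∧ MoreDelayed lt' lt

namespace Flow

variable {Γ : OpenGraph V}

/-- The `Z`-correction digraph of the flow pattern
`∏_{i ∈ Oᶜ} X_{f(i)}^{s_i} Z_{N(f(i)) \ {i}}^{s_i} M_i`: there is an edge from `i` to `j` when the
pattern contains the command `Z_j^{s_i}`. -/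
def ZEdge (F : Γ.Flow) (i j : V) : Prop :=
  ∃ h : i ∉ Γ.O, j ∈ Γ.G.neighborSet (F.f ⟨i, h⟩) \ {i}

/-- The `Z`-paths from `i` to `j`: directed paths in the `Z`-correction digraph, each given by the
list of its vertices. For `i = j` the one-vertex path is the only one. -/
def zPaths (F : Γ.Flow) (i j : V) : Set (List V) :=
  {l | l.IsChain F.ZEdge ∧ l.Nodup ∧ l.head? = some i ∧ l.getLast? = some j}

/-- `ζ_i(j)`: the number of `Z`-paths from `i` to `j`. -/
noncomputable def zeta (F : Γ.Flow) (i j : V) : ℕ := (F.zPaths i j).ncard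

/-- The correcting sets of the signal shifted flow: `j ∈ s(i)` when `f⁻¹(j)` exists and
`ζ_i(f⁻¹(j))` is odd. -/
def shifted (F : Γ.Flow) (i : {v : V // v ∉ Γ.O}) : Set V :=
  {j | ∃ k, (F.f k : V) = j ∧ Odd (F.zeta i k)}

theorem lt_of_zEdge (F : Γ.Flow) {i j : V} (h : F.ZEdge i j) : F.lt i j := by
  obtain ⟨hi, hj, hne⟩ := h
  exact (F.F2 ⟨i, hi⟩ j hj).resolve_left hne

theorem eq_or_lt_of_isChain (F : Γ.Flow) {j : V} (l : List V) (i : V)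
    (hc : l.IsChain F.ZEdge) (hh : l.head? = some i) (hl : l.getLast? = some j) :
    i = j ∨ F.lt i j := by
  induction l generalizing i with
  | nil => simp at hh
  | cons a t ih =>
    obtain rfl : a = i := by simpa using hh
    cases t with
    | nil => exact Or.inl (by simpa using hl)
    | cons b t =>
      rw [List.isChain_cons_cons] at hc
      have hab := F.lt_of_zEdge hc.1
      rw [List.getLast?_cons_cons] at hl
      rcases ih b hc.2 rfl hl with rfl | hb
      · exact Or.inr hab
      · exact Or.inr (F.strictOrder.trans _ _ _ hab hb)

/-- Correcting vertices of `i` come after `i` in the order of the flow. -/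
theorem lt_of_mem_shifted (F : Γ.Flow) {i : {v : V // v ∉ Γ.O}} {j : V}
    (h : j ∈ F.shifted i) : F.lt i j := by
  obtain ⟨k, rfl, hodd⟩ := h
  obtain ⟨l, hc, -, hh, hl⟩ := Set.nonempty_of_ncard_ne_zero hodd.pos.ne'
  rcases F.eq_or_lt_of_isChain l i hc hh hl with hik | hik
  · rw [hik]
    exact F.F1 k
  · exact F.strictOrder.trans _ _ _ hik (F.F1 k)

variable [Fintype V]

open Classical in
/-- The layering function `L_s` of the signal shifted flow: `L_s(i) = 0` for outputs `i` and
`L_s(i) = max_{j ∈ s(i)} (L_s(j) + 1)` for all other `i`. -/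
noncomputable def shiftedLayering (F : Γ.Flow) (i : V) : ℕ :=
  if h : i ∈ Γ.O then 0
  else (Finset.univ : Finset (F.shifted ⟨i, h⟩)).sup fun j => F.shiftedLayering j + 1
termination_by (Finset.univ.filter fun v => F.lt i v).card
decreasing_by
  have hij : F.lt i j := F.lt_of_mem_shifted j.2
  apply Finset.card_lt_card
  rw [Finset.ssubset_iff_of_subset]
  · exact ⟨j, by simpa using hij, by simpa using F.strictOrder.irrefl (j : V)⟩
  · intro v hv
    have hv' : F.lt j v := by simpa using hv
    simpa using F.strictOrder.trans _ _ _ hij hv'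

/-- The strict order of the signal shifted flow: `i ≺_s j` when `L_s(i) > L_s(j)`. -/
def shiftedLT (F : Γ.Flow) (i j : V) : Prop :=
  F.shiftedLayering i > F.shiftedLayering j

end Flow

end OpenGraph

namespace OpenGraph

variable {V : Type*}

/-! ### Layers of a strict order -/

section Layers

/-! Over `ZMod 2`, let `A` be the adjacency matrix with columns the non-inputs and rows the
non-outputs. Path counting gives `A (chi (s i)) = e_i` (`adjAct_chi_shifted`). If `|I| = |O|`, then
`f` is a bijection that makes `A` square and unitriangular, hence injective. So for any gflow `g`,
`chi (g i)` is the sum of `chi (s k)` over the non-outputs `k` in the odd neighbourhood of `g i`.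
Induction along the gflow order then gives `i ≺ j` for every `j ∈ s i`
(`lt_of_isGFlow_of_mem_shifted`). As `L_s` is the longest-chain height for these forced relations,
each cumulative layer of `g` lies in that of `s`, which yields optimality and uniqueness of the
layering. -/

theorem mem_layer_iff (lt : V → V → Prop) (k : ℕ) (u : V) :
    u ∈ layer lt k ↔ (∀ i < k, u ∉ layer lt i) ∧
      ∀ v, (∀ i < k, v ∉ layer lt i) → ¬ lt u v := by
  rw [layer, maxElements]
  have key : ∀ w, w ∈ (Set.univ \ ⋃ i : Fin k, layer lt i) ↔ ∀ i < k, w ∉ layer lt i := by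
    intro w
    simp only [Set.mem_sdiff, Set.mem_univ, true_and, Set.mem_iUnion, not_exists]
    exact ⟨fun h i hi => h ⟨i, hi⟩, fun h i => h i i.2⟩
  simp only [Set.mem_ofPred_eq, key]

theorem mem_layersUpTo_iff (lt : V → V → Prop) (k : ℕ) (u : V) :
    u ∈ layersUpTo lt k ↔ ∃ i ≤ k, u ∈ layer lt i := by
  simp [layersUpTo]

theorem mem_layer_iff_layersUpTo (lt : V → V → Prop) (k : ℕ) (u : V) :
    u ∈ layer lt k ↔ u ∈ layersUpTo lt k ∧ ∀ i < k, u ∉ layer lt i := by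
  rw [mem_layersUpTo_iff]
  constructor
  · intro h
    exact ⟨⟨k, le_rfl, h⟩, ((mem_layer_iff lt k u).1 h).1⟩
  · rintro ⟨⟨i, hi, hu⟩, h⟩
    rcases hi.lt_or_eq with hlt | rfl
    · exact absurd hu (h i hlt)
    · exact hu

theorem layer_eq_of_layersUpTo_eq {lt lt' : V → V → Prop}
    (h : ∀ k, layersUpTo lt k = layersUpTo lt' k) (k : ℕ) : layer lt k = layer lt' k := by
  induction k using Nat.strong_induction_on with
  | _ k ih =>
    ext u
    rw [mem_layer_iff_layersUpTo, mem_layer_iff_layersUpTo, h k]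
    refine and_congr_right fun _ => forall₂_congr fun i hi => ?_
    rw [ih i hi]

/-- The layers of the order induced by a level function whose values form an initial segment. -/
theorem layer_level_eq (L : V → ℕ) (hL : ∀ u k, L u = k + 1 → ∃ v, L v = k) (k : ℕ) :
    layer (fun i j => L i > L j) k = {u | L u = k} := by
  have descend : ∀ n u, L u = n → ∀ m ≤ n, ∃ v, L v = m := by
    intro n
    induction n with
    | zero => intro u hu m hm; exact ⟨u, by omega⟩
    | succ n ih =>
      intro u hu m hm
      rcases hm.lt_or_eq with h | rfl
      · obtain ⟨v, hv⟩ := hL u n hu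
        exact ih v hv m (by omega)
      · exact ⟨u, hu⟩
  induction k using Nat.strong_induction_on with
  | _ k ih =>
    have key : ∀ w, (∀ i < k, w ∉ layer (fun i j => L i > L j) i) ↔ k ≤ L w := by
      intro w
      constructor
      · intro h
        by_contra! hlt
        exact h _ hlt (by rw [ih _ hlt]; rfl)
      · intro h i hi hw
        rw [ih i hi] at hw
        have : L w = i := hw
        omega
    ext u
    rw [mem_layer_iff]
    simp only [key, Set.mem_ofPred_eq]
    -- If `L u > k`, some vertex has level exactly `k`; it is still present and above `u`, so `u` is
    -- not maximal.
    constructor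
    · rintro ⟨hk, hmax⟩
      obtain ⟨v, hv⟩ := descend _ u rfl k hk
      have := hmax v hv.ge
      omega
    · intro h
      exact ⟨h.ge, fun v hv => by omega⟩

end Layers

/-! ### Odd neighbourhoods as linear algebra over `ZMod 2` -/

section OddNeighborhood

variable [Fintype V]

open Classical in
/-- The adjacency operator over `ZMod 2`. -/
noncomputable def adjAct (Γ : OpenGraph V) (x : V → ZMod 2) (v : V) : ZMod 2 :=
  ∑ w, if Γ.G.Adj v w then x w else 0

open Classical in
/-- The indicator vector of a set over `ZMod 2`. -/
noncomputable def chi (K : Set V) (v : V) : ZMod 2 := if v ∈ K then 1 else 0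

theorem adjAct_chi (Γ : OpenGraph V) (K : Set V) (v : V) :
    Γ.adjAct (chi K) v = ((Γ.G.neighborSet v ∩ K).ncard : ZMod 2) := by
  classical
  rw [Set.ncard_eq_toFinset_card', adjAct]
  simp only [chi, ← ite_and]
  rw [Finset.sum_boole]
  congr 2
  ext w
  simp

theorem mem_oddNeighborhood_iff (Γ : OpenGraph V) (K : Set V) (v : V) :
    v ∈ Γ.oddNeighborhood K ↔ Γ.adjAct (chi K) v = 1 := by
  rw [adjAct_chi, ZMod.natCast_eq_one_iff_odd]
  rfl

theorem adjAct_add (Γ : OpenGraph V) (x y : V → ZMod 2) (v : V) :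
    Γ.adjAct (fun w => x w + y w) v = Γ.adjAct x v + Γ.adjAct y v := by
  simp only [adjAct, ← Finset.sum_add_distrib]
  refine Finset.sum_congr rfl fun w _ => ?_
  split_ifs <;> simp

theorem adjAct_sum_mul (Γ : OpenGraph V) {ι : Type*} (s : Finset ι) (c : ι → ZMod 2)
    (x : ι → V → ZMod 2) (v : V) :
    Γ.adjAct (fun w => ∑ k ∈ s, c k * x k w) v = ∑ k ∈ s, c k * Γ.adjAct (x k) v := by
  simp only [adjAct, Finset.mul_sum]
  rw [Finset.sum_comm]
  refine Finset.sum_congr rfl fun w _ => ?_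
  split_ifs <;> simp

end OddNeighborhood

/-! ### The flow function and path counts -/

namespace Flow

variable {Γ : OpenGraph V}

theorem f_injective (F : Γ.Flow) : Function.Injective F.f := by
  intro i j hij
  by_contra hne
  have hne' : (i : V) ≠ j := fun h => hne (Subtype.ext h)
  have h1 := (F.F2 j i (hij ▸ F.F3 i)).resolve_left hne'
  have h2 := (F.F2 i j (hij ▸ F.F3 j)).resolve_left hne'.symm
  exact F.strictOrder.irrefl _ (F.strictOrder.trans _ _ _ h1 h2)

/-- Everything that needs `|I| = |O|` needs it through this lemma. -/
theorem f_surjective [Fintype V] (F : Γ.Flow) (hcard : Γ.I.card = Γ.O.card) :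
    Function.Surjective F.f := by
  classical
  refine ((Fintype.bijective_iff_injective_and_card F.f).2 ⟨F.f_injective, ?_⟩).2
  rw [Fintype.card_subtype_compl, Fintype.card_subtype_compl, Fintype.card_coe, Fintype.card_coe,
    hcard]

section Paths

/-- Edges ascend in the flow order, so walks never revisit a vertex. -/
theorem nodup_of_isChain (F : Γ.Flow) {l : List V} (hc : l.IsChain F.ZEdge) : l.Nodup := by
  have : IsTrans V F.lt := ⟨F.strictOrder.trans⟩
  have h : l.Pairwise F.lt := (hc.imp fun _ _ => F.lt_of_zEdge).pairwise
  refine h.imp ?_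
  rintro a _ hab rfl
  exact F.strictOrder.irrefl a hab

theorem mem_zPaths_iff (F : Γ.Flow) {i j : V} {l : List V} :
    l ∈ F.zPaths i j ↔ l.IsChain F.ZEdge ∧ l.head? = some i ∧ l.getLast? = some j :=
  ⟨fun h => ⟨h.1, h.2.2⟩, fun h => ⟨h.1, F.nodup_of_isChain h.1, h.2⟩⟩

theorem eq_or_lt_of_zeta_ne_zero (F : Γ.Flow) {i j : V} (h : F.zeta i j ≠ 0) :
    i = j ∨ F.lt i j := by
  obtain ⟨l, hc, -, hh, hl⟩ := Set.nonempty_of_ncard_ne_zero h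
  exact F.eq_or_lt_of_isChain l i hc hh hl

theorem zPaths_self (F : Γ.Flow) (i : V) : F.zPaths i i = {[i]} := by
  ext l
  constructor
  · rintro ⟨-, hn, hh, hl⟩
    match l with
    | [] => simp at hh
    | [a] => simpa using hh
    | a :: b :: t =>
      obtain rfl : a = i := by simpa using hh
      rw [List.getLast?_cons_cons] at hl
      exact absurd (List.mem_of_getLast? hl) (List.nodup_cons.1 hn).1
  · rintro rfl
    simp [zPaths]

theorem zeta_self (F : Γ.Flow) (i : V) : F.zeta i i = 1 := by
  rw [zeta, zPaths_self, Set.ncard_singleton]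

theorem zPaths_eq_iUnion (F : Γ.Flow) {i j : V} (hij : i ≠ j) :
    F.zPaths i j = ⋃ k ∈ {k | F.ZEdge k j}, (fun l => l ++ [j]) '' F.zPaths i k := by
  ext l
  simp only [Set.mem_iUnion, Set.mem_image, exists_prop, Set.mem_ofPred_eq]
  constructor
  · intro h
    obtain ⟨hc, hh, hl⟩ := F.mem_zPaths_iff.1 h
    obtain ⟨t, rfl⟩ := List.getLast?_eq_some_iff.1 hl
    rw [List.isChain_append] at hc
    obtain ⟨ht, -, hlast⟩ := hc
    have htne : t ≠ [] := by
      rintro rfl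
      exact hij (by simpa using hh.symm)
    have hgl := List.getLast?_eq_some_getLast htne
    refine ⟨t.getLast htne, hlast _ hgl j (by simp), t, F.mem_zPaths_iff.2 ⟨ht, ?_, hgl⟩, rfl⟩
    rwa [List.head?_append_of_ne_nil _ htne] at hh
  · rintro ⟨k, hk, t, ht, rfl⟩
    obtain ⟨hc, hh, hl⟩ := F.mem_zPaths_iff.1 ht
    refine F.mem_zPaths_iff.2 ⟨?_, ?_, by simp⟩
    · rw [List.isChain_append]
      refine ⟨hc, by simp, ?_⟩
      intro a ha b hb
      obtain rfl : k = a := by simpa [hl] using ha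
      obtain rfl : j = b := by simpa using hb
      exact hk
    · rw [List.head?_append, hh]
      rfl

variable [Fintype V]

theorem finite_zPaths (F : Γ.Flow) (i j : V) : (F.zPaths i j).Finite :=
  (List.finite_length_le V (Fintype.card V)).subset fun _ h => h.2.1.length_le_card

-- Deleting the last vertex sorts the paths by their penultimate vertex. The trivial path has none,
-- hence `i ≠ j`.
open Classical in
theorem zeta_eq_sum (F : Γ.Flow) {i j : V} (hij : i ≠ j) :
    F.zeta i j = ∑ k with F.ZEdge k j, F.zeta i k := by
  have hinj : Function.Injective (fun l : List V => l ++ [j]) := fun a b h => by simpa using h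
  have hset : F.zPaths i j = ⋃ k ∈ Finset.univ.filter (fun k => F.ZEdge k j),
      (fun l => l ++ [j]) '' F.zPaths i k := by
    rw [F.zPaths_eq_iUnion hij]
    simp
  have hcoe : (F.zPaths i j) = ((Finset.univ.filter (fun k => F.ZEdge k j)).biUnion
      fun k => ((F.finite_zPaths i k).toFinset.image fun l => l ++ [j]) : Finset (List V)) := by
    rw [hset]
    simp
  rw [zeta, hcoe, Set.ncard_coe_finset, Finset.card_biUnion]
  · refine Finset.sum_congr rfl fun k _ => ?_
    rw [Finset.card_image_of_injective _ hinj, zeta, Set.ncard_eq_toFinset_card _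
      (F.finite_zPaths i k)]
  · intro k _ k' _ hkk
    refine Finset.disjoint_left.2 ?_
    intro l hl hl'
    simp only [Finset.mem_image, Set.Finite.mem_toFinset] at hl hl'
    obtain ⟨t, ht, rfl⟩ := hl
    obtain ⟨t', ht', he⟩ := hl'
    obtain rfl := hinj he
    exact hkk (Option.some.inj (ht.2.2.2.symm.trans ht'.2.2.2))

end Paths

/-! ### Shifted sets and inversion of the adjacency operator -/

theorem chi_shifted_f (F : Γ.Flow) (i k : {v : V // v ∉ Γ.O}) :
    chi (F.shifted i) (F.f k : V) = (F.zeta i k : ZMod 2) := by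
  have hmem : (F.f k : V) ∈ F.shifted i ↔ Odd (F.zeta i k) := by
    constructor
    · rintro ⟨k', hk', h⟩
      rwa [F.f_injective (Subtype.ext hk')] at h
    · exact fun h => ⟨k, rfl, h⟩
  rw [chi]
  split_ifs with h
  · exact ((ZMod.natCast_eq_one_iff_odd).2 (hmem.1 h)).symm
  · rw [hmem, Nat.not_odd_iff_even] at h
    exact ((ZMod.natCast_eq_zero_iff_even).2 h).symm

theorem notMem_I_of_mem_shifted (F : Γ.Flow) {i : {v : V // v ∉ Γ.O}} {j : V}
    (h : j ∈ F.shifted i) : j ∉ Γ.I := by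
  obtain ⟨k, rfl, -⟩ := h
  exact (F.f k).2

theorem f_mem_shifted (F : Γ.Flow) (i : {v : V // v ∉ Γ.O}) : (F.f i : V) ∈ F.shifted i :=
  ⟨i, rfl, by rw [zeta_self]; exact odd_one⟩

variable [Fintype V]

open Classical in
/-- The adjacency operator evaluated on a vector supported on the range of `f`. -/
theorem adjAct_eq_sum_f (F : Γ.Flow) {x : V → ZMod 2}
    (hx : ∀ v, x v ≠ 0 → ∃ k, (F.f k : V) = v) (j : V) :
    Γ.adjAct x j = ∑ k, if Γ.G.Adj j (F.f k) then x (F.f k) else 0 := by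
  symm
  have hinj : Function.Injective (fun k => (F.f k : V)) :=
    Subtype.val_injective.comp F.f_injective
  refine Finset.sum_of_injOn (fun k => (F.f k : V)) hinj.injOn (by simp) ?_ (fun _ _ => rfl)
  intro v _ hv
  by_cases h0 : x v = 0
  · simp [h0]
  · obtain ⟨k, rfl⟩ := hx v h0
    simp at hv

open Classical in
/-- The odd neighbourhood of a correcting set of the signal shifted flow meets the non-outputs
only in the corrected vertex. -/
theorem adjAct_chi_shifted (F : Γ.Flow) (i j : {v : V // v ∉ Γ.O}) :
    Γ.adjAct (chi (F.shifted i)) j = if i = j then 1 else 0 := by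
  rw [F.adjAct_eq_sum_f (x := chi (F.shifted i))]
  swap
  · intro v hv
    have : v ∈ F.shifted i := by
      by_contra h
      exact hv (by simp [chi, h])
    obtain ⟨k, hk, -⟩ := this
    exact ⟨k, hk⟩
  simp only [chi_shifted_f]
  -- The term `k = j` is `ζ_i(j)`; the others run over the edges `k → j`.
  rw [← Finset.add_sum_erase _ _ (Finset.mem_univ j), if_pos (F.F3 j).symm]
  have hadj : ∀ k ∈ Finset.univ.erase j, (Γ.G.Adj j (F.f k) ↔ F.ZEdge k j) := by
    intro k hk
    have hne : (j : V) ≠ k := fun h => (Finset.ne_of_mem_erase hk) (Subtype.ext h.symm)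
    exact ⟨fun h => ⟨k.2, h.symm, hne⟩, fun ⟨_, h, _⟩ => SimpleGraph.Adj.symm h⟩
  -- For `i = j` the other terms vanish by acyclicity; for `i ≠ j` they sum to `ζ_i(j)` again and
  -- cancel the first term mod 2.
  split_ifs with hij
  · subst hij
    rw [zeta_self, Finset.sum_eq_zero, Nat.cast_one, add_zero]
    intro k hk
    split_ifs with h
    · have hlt := F.lt_of_zEdge ((hadj k hk).1 h)
      by_contra hz
      have hz' : F.zeta i k ≠ 0 := fun h0 => hz (by simp [h0])
      rcases F.eq_or_lt_of_zeta_ne_zero hz' with he | hlt'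
      · exact Finset.ne_of_mem_erase hk (Subtype.ext he.symm)
      · exact F.strictOrder.irrefl _ (F.strictOrder.trans _ _ _ hlt hlt')
    · rfl
  · have hne : (i : V) ≠ j := fun h => hij (Subtype.ext h)
    have hsum : (F.zeta i j : ZMod 2) = ∑ k ∈ Finset.univ.erase j,
        if Γ.G.Adj j (F.f k) then (F.zeta i k : ZMod 2) else 0 := by
      rw [F.zeta_eq_sum hne, Nat.cast_sum, ← Finset.sum_filter]
      symm
      refine Finset.sum_of_injOn (fun k => (k : V)) Subtype.val_injective.injOn ?_ ?_
        (fun _ _ => rfl)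
      · intro k hk
        simp only [Finset.coe_filter, Set.mem_ofPred_eq] at hk
        simpa using (hadj k hk.1).1 hk.2
      · intro v hv hv'
        exfalso
        have hz : F.ZEdge v j := by simpa using hv
        obtain ⟨hO, hN, hvj⟩ := hz
        refine hv' ⟨⟨v, hO⟩, ?_, rfl⟩
        have hm : (⟨v, hO⟩ : {v : V // v ∉ Γ.O}) ∈ Finset.univ.erase j := by
          refine Finset.mem_erase.2 ⟨fun h => hvj ?_, Finset.mem_univ _⟩
          simp [← h]
        exact Finset.mem_coe.2 (Finset.mem_filter.2 ⟨hm, (hadj _ hm).2 ⟨hO, hN, hvj⟩⟩)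
    rw [← hsum, CharTwo.add_self_eq_zero]

/-- If `|I| = |O|`, the adjacency operator from non-inputs to non-outputs is injective. -/
theorem eq_zero_of_adjAct_eq_zero (F : Γ.Flow) (hcard : Γ.I.card = Γ.O.card) {x : V → ZMod 2}
    (hI : ∀ v ∈ Γ.I, x v = 0) (hO : ∀ v ∉ Γ.O, Γ.adjAct x v = 0) : x = 0 := by
  classical
  have hsupp : ∀ v, x v ≠ 0 → ∃ k, (F.f k : V) = v := by
    intro v hv
    obtain ⟨k, hk⟩ := F.f_surjective hcard ⟨v, fun h => hv (hI v h)⟩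
    exact ⟨k, by rw [hk]⟩
  -- Forward substitution: row `v` involves only `f v` and `f k` with `k ≺ v`.
  have hf : ∀ v, ∀ h : v ∉ Γ.O, x (F.f ⟨v, h⟩) = 0 := by
    have := F.strictOrder
    have hwf : WellFounded F.lt := Finite.wellFounded_of_trans_of_irrefl F.lt
    intro v
    induction v using hwf.induction with
    | _ v ih =>
      intro h
      have hz := hO v h
      rw [F.adjAct_eq_sum_f hsupp, Finset.sum_eq_single ⟨v, h⟩, if_pos (F.F3 ⟨v, h⟩).symm] at hz
      · exact hz
      · intro k _ hk
        split_ifs with hadj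
        · refine ih k ?_ k.2
          exact (F.F2 k v hadj.symm).resolve_left fun e => hk (Subtype.ext e.symm)
        · rfl
      · simp
  funext v
  by_contra hv
  obtain ⟨k, rfl⟩ := hsupp v hv
  exact hv (hf k k.2)

/-- The order of any gflow extends the dependencies of the signal shifted flow. -/
theorem lt_of_isGFlow_of_mem_shifted (F : Γ.Flow) (hcard : Γ.I.card = Γ.O.card)
    {g : {v : V // v ∉ Γ.O} → Set V} {lt : V → V → Prop} (hg : Γ.IsGFlow g lt) (i : V) :
    ∀ (hi : i ∉ Γ.O) (j : V), j ∈ F.shifted ⟨i, hi⟩ → lt i j := by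
  classical
  have := hg.strictOrder
  have hwf : WellFounded (Function.swap lt) := Finite.wellFounded_of_trans_of_irrefl _
  induction i using hwf.induction with
  | _ i ih =>
    intro hi j hj
    by_contra hij
    -- The difference (mod 2) between `g i` and its expansion in shifted sets; injectivity makes it
    -- zero.
    let x : V → ZMod 2 := fun w => chi (g ⟨i, hi⟩) w +
      ∑ k : {v : V // v ∉ Γ.O}, Γ.adjAct (chi (g ⟨i, hi⟩)) k * chi (F.shifted k) w
    have hx : x = 0 := by
      refine F.eq_zero_of_adjAct_eq_zero hcard ?_ ?_
      · intro v hv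
        have h1 : chi (g ⟨i, hi⟩) v = 0 := if_neg fun h => hg.nonInput _ v h hv
        have h2 : ∀ k, chi (F.shifted k) v = 0 := fun k =>
          if_neg fun h => F.notMem_I_of_mem_shifted h hv
        simp [x, h1, h2]
      · intro v hv
        rw [adjAct_add, adjAct_sum_mul]
        have : ∀ k, Γ.adjAct (chi (F.shifted k)) v = if k = ⟨v, hv⟩ then 1 else 0 :=
          fun k => F.adjAct_chi_shifted k ⟨v, hv⟩
        simp [this, CharTwo.add_self_eq_zero]
    -- If `i ⊀ j`, then `j ∉ g i`, and a term `k ≠ i` containing `j` would give `i ≺ k ≺ j`. Only `k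
    -- = i` survives.
    have hxj : x j = 1 := by
      have h1 : chi (g ⟨i, hi⟩) j = 0 := if_neg fun h => hij (hg.G1 _ j h)
      have h2 : Γ.adjAct (chi (g ⟨i, hi⟩)) i = 1 :=
        (mem_oddNeighborhood_iff _ _ _).1 (hg.G3 ⟨i, hi⟩)
      have h3 : chi (F.shifted ⟨i, hi⟩) j = 1 := if_pos hj
      simp only [x, h1, zero_add]
      rw [Finset.sum_eq_single ⟨i, hi⟩, h2, h3, one_mul]
      · intro k _ hk
        by_cases h0 : Γ.adjAct (chi (g ⟨i, hi⟩)) k = 0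
        · rw [h0, zero_mul]
        have hk1 : (k : V) ∈ Γ.oddNeighborhood (g ⟨i, hi⟩) := by
          rw [mem_oddNeighborhood_iff]
          exact Fin.eq_one_of_ne_zero _ h0
        have hik : lt i k := (hg.G2 _ k hk1).resolve_left fun e => hk (Subtype.ext e)
        have : chi (F.shifted k) j = 0 :=
          if_neg fun h => hij (hg.strictOrder.trans _ _ _ hik (ih k hik k.2 j h))
        rw [this, mul_zero]
      · simp
    rw [hx] at hxj
    exact zero_ne_one hxj

/-! ### Levels of the shifted flow and comparison with other gflows -/

theorem shiftedLayering_of_mem (F : Γ.Flow) {i : V} (h : i ∈ Γ.O) : F.shiftedLayering i = 0 := by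
  rw [shiftedLayering, dif_pos h]

theorem shiftedLayering_lt (F : Γ.Flow) {i : {v : V // v ∉ Γ.O}} {j : V}
    (h : j ∈ F.shifted i) : F.shiftedLayering j < F.shiftedLayering i := by
  classical
  rw [shiftedLayering.eq_1 F i, dif_neg i.2]
  exact Finset.le_sup (f := fun j : F.shifted ⟨i, i.2⟩ => F.shiftedLayering j + 1)
    (Finset.mem_univ ⟨j, h⟩)

theorem exists_mem_shifted_shiftedLayering (F : Γ.Flow) (i : {v : V // v ∉ Γ.O}) :
    ∃ j ∈ F.shifted i, F.shiftedLayering i = F.shiftedLayering j + 1 := by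
  classical
  -- Since `f i ∈ s i`, the supremum is attained and is not the default `0` of an empty set.
  have hne : (Finset.univ : Finset (F.shifted ⟨i, i.2⟩)).Nonempty :=
    ⟨⟨_, F.f_mem_shifted i⟩, Finset.mem_univ _⟩
  obtain ⟨j, -, hj⟩ := Finset.exists_mem_eq_sup _ hne
    (fun j : F.shifted ⟨i, i.2⟩ => F.shiftedLayering j + 1)
  refine ⟨j, j.2, ?_⟩
  rw [shiftedLayering.eq_1 F i, dif_neg i.2]
  exact hj

theorem isGFlow_shifted (F : Γ.Flow) : Γ.IsGFlow F.shifted F.shiftedLT where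
  strictOrder :=
    { irrefl := fun a => lt_irrefl (F.shiftedLayering a)
      trans := fun _ _ _ hab hbc => lt_trans hbc hab }
  nonInput _ _ h := F.notMem_I_of_mem_shifted h
  G1 _ _ h := F.shiftedLayering_lt h
  G2 i j h := by
    rw [mem_oddNeighborhood_iff] at h
    -- Outputs have level `0`, while `f i ∈ s i` puts `i` at level at least `1`.
    by_cases hj : j ∈ Γ.O
    · right
      have := F.shiftedLayering_lt (F.f_mem_shifted i)
      rw [shiftedLT, F.shiftedLayering_of_mem hj]
      omega
    · left
      rw [F.adjAct_chi_shifted i ⟨j, hj⟩] at h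
      by_contra hne
      rw [if_neg fun e => hne (congrArg Subtype.val e).symm] at h
      exact zero_ne_one h
  G3 i := by
    rw [mem_oddNeighborhood_iff, F.adjAct_chi_shifted, if_pos rfl]

theorem layer_shiftedLT (F : Γ.Flow) (k : ℕ) :
    layer F.shiftedLT k = {u | F.shiftedLayering u = k} := by
  refine layer_level_eq F.shiftedLayering (fun u k hu => ?_) k
  have hO : u ∉ Γ.O := fun h => by simp [F.shiftedLayering_of_mem h] at hu
  obtain ⟨j, -, hj⟩ := F.exists_mem_shifted_shiftedLayering ⟨u, hO⟩
  have hj' : F.shiftedLayering u = F.shiftedLayering j + 1 := hj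
  exact ⟨j, by omega⟩

theorem shiftedLayering_le_of_mem_layer (F : Γ.Flow) (hcard : Γ.I.card = Γ.O.card)
    {g : {v : V // v ∉ Γ.O} → Set V} {lt : V → V → Prop} (hg : Γ.IsGFlow g lt) (k : ℕ) :
    ∀ u ∈ layer lt k, F.shiftedLayering u ≤ k := by
  induction k using Nat.strong_induction_on with
  | _ k ih =>
    intro u hu
    by_cases hO : u ∈ Γ.O
    · simp [F.shiftedLayering_of_mem hO]
    -- A `j` attaining the maximum lies above `u` in the gflow order, hence in an earlier layer.
    obtain ⟨j, hj, he⟩ := F.exists_mem_shifted_shiftedLayering ⟨u, hO⟩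
    have hlt := F.lt_of_isGFlow_of_mem_shifted hcard hg u hO j hj
    have hex : ∃ i < k, j ∈ layer lt i := by
      by_contra! hno
      exact ((mem_layer_iff lt k u).1 hu).2 j hno hlt
    obtain ⟨i, hi, hji⟩ := hex
    have := ih i hi j hji
    have he' : F.shiftedLayering u = F.shiftedLayering j + 1 := he
    omega

theorem layersUpTo_subset_shifted (F : Γ.Flow) (hcard : Γ.I.card = Γ.O.card)
    {g : {v : V // v ∉ Γ.O} → Set V} {lt : V → V → Prop} (hg : Γ.IsGFlow g lt) (k : ℕ) :
    layersUpTo lt k ⊆ layersUpTo F.shiftedLT k := by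
  intro u hu
  obtain ⟨i, hi, hui⟩ := (mem_layersUpTo_iff _ _ _).1 hu
  refine (mem_layersUpTo_iff _ _ _).2 ⟨F.shiftedLayering u,
    (F.shiftedLayering_le_of_mem_layer hcard hg i u hui).trans hi, ?_⟩
  rw [layer_shiftedLT]
  rfl

end Flow

end OpenGraph

theorem theorem2 {V : Type*} [Fintype V] (Γ : OpenGraph V) (F : Γ.Flow)
    (hcard : Γ.I.card = Γ.O.card) :
    Γ.IsMaximallyDelayedGFlow F.shifted F.shiftedLT ∧
      ∀ (g : {v : V // v ∉ Γ.O} → Set V) (lt : V → V → Prop),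
        Γ.IsMaximallyDelayedGFlow g lt →
          ∀ k : ℕ, OpenGraph.layer F.shiftedLT k = OpenGraph.layer lt k := by
  refine ⟨⟨F.isGFlow_shifted, ?_⟩, ?_⟩
  · rintro ⟨g, lt, hg, -, k, hk⟩
    exact hk.not_ge (Set.ncard_le_ncard (F.layersUpTo_subset_shifted hcard hg k)
      (Set.toFinite _))
  · rintro g lt ⟨hg, hmax⟩
    have hsub := F.layersUpTo_subset_shifted hcard hg
    refine OpenGraph.layer_eq_of_layersUpTo_eq fun k => ?_
    -- A proper inclusion at a single `k` would make the shifted flow more delayed than `g`.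
    by_contra hne
    refine hmax ⟨F.shifted, F.shiftedLT, F.isGFlow_shifted,
      fun k => Set.ncard_le_ncard (hsub k) (Set.toFinite _), k, ?_⟩
    exact Set.ncard_lt_ncard ((hsub k).ssubset_of_ne (Ne.symm hne)) (Set.toFinite _)
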